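/- Let $L/K$ be a finite separable field extension and let $H$ be a finite-dimensional $K$-bialgebra such that $L/K$ is $H$-Galois. That is, $L$ is a left $H$-module algebra and the canonical map $L\otimes_K H\to \mathrm{End}_K(L)$, $x\otimes h\mapsto (y\mapsto x(h\cdot y))$, is bijective. For an intermediate field $L_0$ put $J(L_0)=\{h\in H\mid h\cdot x=0\ \text{for all } x\in L_0\}$. Call $L_0$ an *$H$-subextension* if the induced map $L\otimes_K H/J(L_0)\to \mathrm{Hom}_K(L_0,L)$ is bijective, and *$H$-normal* if it is an $H$-subextension with $H\cdot L_0\subseteq L_0$. Let $\tilde L$ be a normal closure of $L/K$, $G=\mathrm{Gal}(\tilde L/K)$ and $G'=\mathrm{Gal}(\tilde L/L)$. Then there are a group $N$ of order $[L:K]$ and an isomorphism of bialgebras over $\tilde L$ $$\tau:\tilde L\otimes_K H\;\cong\;\tilde L[N].$$ Fix any group $N$ with such an isomorphism $\tau$, and regard $N$ as a subset of $\tilde L\otimes_K H$ via $\tau$. The rule $g\cdot(y\otimes h)=g(y)\otimes h$ induces an action of $G$ on $N$, and a subgroup $V\subseteq N$ is called *$G$-equivariant* if $g\cdot v\in V$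 for all $g\in G$, $v\in V$. The group $N$ acts from the right on $G/G'\cong\mathrm{Hom}_{K\text{-Alg}}(L,\tilde L)$, $gG'\mapsto g|_L$, through $(f\cdot(y\otimes h))(x)=y\,f(h\cdot x)$, extended linearly. Then the following hold. 1. There are mutually inverse, inclusion-reversing bijections $$\{L_0\mid K\subseteq L_0\subseteq L,\ L_0\text{ an }H\text{-subextension}\}\ \rightleftarrows\ \{V\subseteq N\mid V\text{ a }G\text{-equivariant subgroup}\}.$$ The map to the right sends $L_0$ to $\{n\in N\mid n-1\in\tilde L\otimes_K J(L_0)\}$. The map to the left sends $V$ to $L^{I_V}=\{x\in L\mid h\cdot x=\varepsilon(h)x\ \text{for all } h\in I_V\}$. Here $I_V$ is the left ideal of $H$ generated by the elements $h\in H$ with $1\otimes h\in\tilde L[V]$ and $\varepsilon(h)=0$. 2. Under this bijection $L_0$ is $H$-normal if and only if $V$ is a normal subgroup of $N$. Hence it restricts to a bijection between the $H$-normal intermediate fields and the $G$-equivariant normal subgroups of $N$. 3. The right action of $N$ on $G/G'$ is faithful, so $N$ may be viewed inside $\mathrm{Perm}(G/G')$. A subgroup $V\subseteq N$ is $G$-equivariant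 if and only if its image in $\mathrm{Perm}(G/G')$ is normalized by $\lambda(G)$, the group of left translations of $G/G'$ by elements of $G$. -/

import Mathlib

open scoped TensorProduct

noncomputable section

namespace HopfGalois

/-! ### Module algebras and the canonical map -/

section Action

variable {K H L : Type*} [Field K] [Ring H] [Bialgebra K H] [Field L] [Algebra K L]
  [Module H L] [IsScalarTower K H L]

/-- The `K`-linear map `H → L`, `h ↦ h • x`. -/
def orbitMap (K : Type*) {H L : Type*} [Field K] [Ring H] [Bialgebra K H] [Field L] [Algebra K L]
    [Module H L] [IsScalarTower K H L] (x : L) : H →ₗ[K] L :=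
  (LinearMap.toSpanSingleton H L x).restrictScalars K

/-- `L`, a left `H`-module, is a left `H`-module algebra:
`h • (x y) = (h₍₁₎ • x) (h₍₂₎ • y)` and `h • 1 = ε(h) 1`. -/
structure IsModuleAlgebra (K H L : Type*) [Field K] [Ring H] [Bialgebra K H] [Field L]
    [Algebra K L] [Module H L] [IsScalarTower K H L] : Prop where
  smul_mul : ∀ (h : H) (x y : L), h • (x * y) =
    LinearMap.mul' K L
      (TensorProduct.map (orbitMap K x) (orbitMap K y) (Coalgebra.comul (R := K) h))
  smul_one : ∀ h : H, h • (1 : L) = algebraMap K L (Coalgebra.counit (R := K) h)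

/-- For a `K`-linear map `f : L → E`, the `K`-linear map `H → Hom_K(L, E)`, `h ↦ (x ↦ f (h • x))`. -/
def actHom (H : Type*) {K L E : Type*} [Field K] [Ring H] [Bialgebra K H] [Field L] [Algebra K L]
    [Module H L] [IsScalarTower K H L] [Field E] [Algebra K E] (f : L →ₗ[K] E) :
    H →ₗ[K] (L →ₗ[K] E) where
  toFun h :=
    { toFun := fun x => f (h • x)
      map_add' := fun x y => by rw [smul_add, map_add]
      map_smul' := fun c x => by rw [smul_comm, map_smul, RingHom.id_apply] }
  map_add' h h' := by ext x; simp [add_smul]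
  map_smul' c h := by ext x; simp [smul_assoc]

/-- The right action of `E ⊗ H` on `Hom_K(L, E)`: for a fixed `f`, this is the `E`-linear map
`u ↦ f · u`, where `(f · (y ⊗ h))(x) = y f(h • x)`. -/
def tensorAct (H : Type*) {K L E : Type*} [Field K] [Ring H] [Bialgebra K H] [Field L]
    [Algebra K L] [Module H L] [IsScalarTower K H L] [Field E] [Algebra K E] (f : L →ₗ[K] E) :
    E ⊗[K] H →ₗ[E] (L →ₗ[K] E) :=
  (actHom H f).liftBaseChange E

@[simp] lemma tensorAct_tmul {E : Type*} [Field E] [Algebra K E] (f : L →ₗ[K] E) (y : E) (h : H)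
    (x : L) : tensorAct H f (y ⊗ₜ[K] h) x = y * f (h • x) := by
  simp [tensorAct, actHom]

/-- The canonical map `L ⊗ H → End_K(L)`, `(x ⊗ h) ↦ (y ↦ x (h • y))`. -/
def can (K H L : Type*) [Field K] [Ring H] [Bialgebra K H] [Field L] [Algebra K L]
    [Module H L] [IsScalarTower K H L] : L ⊗[K] H →ₗ[L] (L →ₗ[K] L) :=
  tensorAct H LinearMap.id

/-- `L/K` is `H`-Galois: `L` is an `H`-module algebra and the canonical map is bijective. -/
structure IsHopfGalois (K H L : Type*) [Field K] [Ring H] [Bialgebra K H] [Field L] [Algebra K L]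
    [Module H L] [IsScalarTower K H L] : Prop where
  isModuleAlgebra : IsModuleAlgebra K H L
  bijective_can : Function.Bijective (can K H L)

/-- The annihilator `J(L₀) = {h ∈ H | ∀ x ∈ L₀, h • x = 0}`, as a left ideal of `H`. -/
def annihilator (H : Type*) {K L : Type*} [Field K] [Ring H] [Bialgebra K H] [Field L]
    [Algebra K L] [Module H L] [IsScalarTower K H L] (L₀ : IntermediateField K L) : Ideal H where
  carrier := {h | ∀ x ∈ L₀, h • x = 0}
  add_mem' ha hb x hx := by rw [add_smul, ha x hx, hb x hx, add_zero]
  zero_mem' x _ := zero_smul H x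
  smul_mem' c h hh x hx := by rw [smul_eq_mul, mul_smul, hh x hx, smul_zero]

/-- The canonical map `L ⊗ H/J(L₀) → Hom_K(L₀, L)`, `x ⊗ h̄ ↦ (y ↦ x (h • y))`. -/
def canSub (H : Type*) {K L : Type*} [Field K] [Ring H] [Bialgebra K H] [Field L]
    [Algebra K L] [Module H L] [IsScalarTower K H L] (L₀ : IntermediateField K L) :
    L ⊗[K] (H ⧸ (annihilator H L₀).restrictScalars K) →ₗ[L] (L₀ →ₗ[K] L) :=
  LinearMap.liftBaseChange L
    (((annihilator H L₀).restrictScalars K).liftQ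
      ((LinearMap.lcomp K L L₀.val.toLinearMap) ∘ₗ actHom H LinearMap.id)
      (fun h hh => by
        rw [LinearMap.mem_ker]
        ext x
        exact hh x x.2))

/-- `L₀/K` is an `H`-subextension of `L/K`. -/
def IsHSubextension (H : Type*) {K L : Type*} [Field K] [Ring H] [Bialgebra K H] [Field L]
    [Algebra K L] [Module H L] [IsScalarTower K H L] (L₀ : IntermediateField K L) : Prop :=
  Function.Bijective (canSub H L₀)

/-- `L₀` is `H`-stable: `H • L₀ ⊆ L₀`. -/
def IsHStable (H : Type*) {K L : Type*} [Field K] [Ring H] [Bialgebra K H] [Field L]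
    [Algebra K L] [Module H L] [IsScalarTower K H L] (L₀ : IntermediateField K L) : Prop :=
  ∀ (h : H), ∀ x ∈ L₀, h • x ∈ L₀

/-- `L₀` is `H`-normal: an `H`-stable `H`-subextension. -/
def IsHNormal (H : Type*) {K L : Type*} [Field K] [Ring H] [Bialgebra K H] [Field L]
    [Algebra K L] [Module H L] [IsScalarTower K H L] (L₀ : IntermediateField K L) : Prop :=
  IsHSubextension H L₀ ∧ IsHStable H L₀

/-- The space of `F`-invariants `L^F = {x ∈ L | h • x = ε(h) x for all h ∈ F}`. -/
def invariants (K : Type*) {H : Type*} (L : Type*) [Field K] [Ring H] [Bialgebra K H] [Field L]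
    [Algebra K L] [Module H L] (F : Set H) : Set L :=
  {x | ∀ h ∈ F, h • x = Coalgebra.counit (R := K) h • x}

end Action

/-! ### The group `N` with `E ⊗ H ≅ E[N]` -/

section Group

variable {K H E N : Type*} [Field K] [Ring H] [Bialgebra K H] [Field E] [Algebra K E] [Group N]

/-- The inclusion `N → E[N] ≅ E ⊗ H` attached to an isomorphism `τ : E ⊗ H ≅ E[N]`. -/
def grp (τ : E ⊗[K] H ≃ₐc[E] MonoidAlgebra E N) : N →* E ⊗[K] H :=
  ((τ.symm : MonoidAlgebra E N ≃ₐc[E] E ⊗[K] H) : MonoidAlgebra E N →* E ⊗[K] H).comp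
    (MonoidAlgebra.of E N)

lemma grp_apply (τ : E ⊗[K] H ≃ₐc[E] MonoidAlgebra E N) (n : N) :
    grp τ n = τ.symm (MonoidAlgebra.of E N n) := rfl

lemma isGroupLikeElem_grp (τ : E ⊗[K] H ≃ₐc[E] MonoidAlgebra E N) (n : N) :
    IsGroupLikeElem E (grp τ n) :=
  (MonoidAlgebra.isGroupLikeElem_of n).map τ.symm

lemma grp_injective (τ : E ⊗[K] H ≃ₐc[E] MonoidAlgebra E N) : Function.Injective (grp τ) :=
  fun _ _ h => MonoidAlgebra.of_injective (τ.symm.injective h)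

lemma exists_grp_eq (τ : E ⊗[K] H ≃ₐc[E] MonoidAlgebra E N) {u : E ⊗[K] H}
    (hu : IsGroupLikeElem E u) : ∃ n, grp τ n = u := by
  obtain ⟨n, hn⟩ := MonoidAlgebra.isGroupLikeElem_iff_mem_range_of.1 (hu.map τ)
  exact ⟨n, by rw [grp_apply, hn]; exact τ.symm_apply_apply u⟩

/-- The action of `g ∈ Gal(E/K)` on `E ⊗ H`, `g · (y ⊗ h) = g(y) ⊗ h`. -/
def galTensor (H : Type*) {K E : Type*} [Field K] [Ring H] [Bialgebra K H] [Field E] [Algebra K E]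
    (g : Gal(E/K)) : E ⊗[K] H →ₐ[K] E ⊗[K] H :=
  Algebra.TensorProduct.map (g : E →ₐ[K] E) (AlgHom.id K H)

@[simp] lemma galTensor_tmul (g : Gal(E/K)) (y : E) (h : H) :
    galTensor H g (y ⊗ₜ h) = g y ⊗ₜ h := by
  simp [galTensor]

lemma galTensor_smul (g : Gal(E/K)) (c : E) (u : E ⊗[K] H) :
    galTensor H g (c • u) = g c • galTensor H g u := by
  induction u with
  | zero => simp
  | tmul y h => simp [TensorProduct.smul_tmul']
  | add u v hu hv => simp only [smul_add, map_add, hu, hv]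

/-- `galTensor` as a semilinear map. -/
def galSemi (H : Type*) {K E : Type*} [Field K] [Ring H] [Bialgebra K H] [Field E] [Algebra K E]
    (g : Gal(E/K)) : E ⊗[K] H →ₛₗ[(g : E →+* E)] E ⊗[K] H where
  toFun := galTensor H g
  map_add' := map_add _
  map_smul' c u := galTensor_smul g c u

lemma comul_galTensor (g : Gal(E/K)) (u : E ⊗[K] H) :
    Coalgebra.comul (R := E) (galTensor H g u) =
      TensorProduct.map (galSemi H g) (galSemi H g) (Coalgebra.comul (R := E) u) := by
  induction u with
  | zero => simp
  | add u v hu hv => simp only [map_add, hu, hv]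
  | tmul y h =>
    rw [galTensor_tmul]
    simp only [TensorProduct.comul_tmul, CommSemiring.comul_apply]
    induction Coalgebra.comul (R := K) h with
    | zero => simp
    | add a b ha hb => simp only [TensorProduct.tmul_add, map_add, ha, hb]
    | tmul a b =>
      simp [galSemi]

lemma counit_galTensor (g : Gal(E/K)) (u : E ⊗[K] H) :
    Coalgebra.counit (R := E) (galTensor H g u) = g (Coalgebra.counit (R := E) u) := by
  induction u with
  | zero => simp
  | add u v hu hv => simp only [map_add, hu, hv]
  | tmul y h => simp

lemma isGroupLikeElem_galTensor (g : Gal(E/K)) {u : E ⊗[K] H} (hu : IsGroupLikeElem E u) :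
    IsGroupLikeElem E (galTensor H g u) where
  counit_eq_one := by rw [counit_galTensor, hu.counit_eq_one, map_one]
  comul_eq_tmul_self := by rw [comul_galTensor, hu.comul_eq_tmul_self]; rfl

/-- The element `g · n` of `N`, for `g ∈ Gal(E/K)` and `n ∈ N`: it is the element which
`g · (y ⊗ h) = g(y) ⊗ h` induces under `N ⊆ E[N] ≅ E ⊗ H`, see `grp_galAct`. -/
def galAct (τ : E ⊗[K] H ≃ₐc[E] MonoidAlgebra E N) (g : Gal(E/K)) (n : N) : N :=
  (exists_grp_eq τ (isGroupLikeElem_galTensor g (isGroupLikeElem_grp τ n))).choose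

lemma grp_galAct (τ : E ⊗[K] H ≃ₐc[E] MonoidAlgebra E N) (g : Gal(E/K)) (n : N) :
    grp τ (galAct τ g n) = galTensor H g (grp τ n) :=
  (exists_grp_eq τ (isGroupLikeElem_galTensor g (isGroupLikeElem_grp τ n))).choose_spec

/-- `V ⊆ N` is `G`-equivariant, `G = Gal(E/K)`: `g · v ∈ V` for all `g ∈ G`, `v ∈ V`. -/
def IsGEquivariant (τ : E ⊗[K] H ≃ₐc[E] MonoidAlgebra E N) (V : Subgroup N) : Prop :=
  ∀ (g : Gal(E/K)), ∀ v ∈ V, galAct τ g v ∈ V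

lemma mul_mem_baseChange (I : Ideal H) (u v : E ⊗[K] H)
    (hv : v ∈ (I.restrictScalars K).baseChange E) :
    u * v ∈ (I.restrictScalars K).baseChange E := by
  rw [Submodule.baseChange_eq_span] at hv ⊢
  induction hv using Submodule.span_induction with
  | zero => simp
  | add x y _ _ hx hy => rw [mul_add]; exact add_mem hx hy
  | smul c x _ hx => rw [mul_smul_comm]; exact Submodule.smul_mem _ c hx
  | mem x hx =>
    obtain ⟨h, hh, rfl⟩ := hx
    induction u with
    | zero => simp
    | add a b ha hb => rw [add_mul]; exact add_mem ha hb
    | tmul y k =>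
      have : (y ⊗ₜ[K] k) * (TensorProduct.mk K E H 1 h) = y • ((1 : E) ⊗ₜ[K] (k * h)) := by
        simp [TensorProduct.smul_tmul']
      rw [this]
      exact Submodule.smul_mem _ _ (Submodule.subset_span ⟨k * h, I.mul_mem_left k hh, rfl⟩)

/-- The subgroup of `N` attached to a left ideal `I` of `H`: it consists of the `n ∈ N` that have
the same image as `1` in `E[N] / (E ⊗ I) ≅ E ⊗ H/I`. (If this quotient is `E[N/V]`, it is `V`.) -/
def subgroupOfIdeal (τ : E ⊗[K] H ≃ₐc[E] MonoidAlgebra E N) (I : Ideal H) : Subgroup N where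
  carrier := {n | grp τ n - 1 ∈ (I.restrictScalars K).baseChange E}
  one_mem' := by simp
  mul_mem' {a b} ha hb := by
    have : grp τ (a * b) - 1 = grp τ a * (grp τ b - 1) + (grp τ a - 1) := by
      rw [map_mul, mul_sub, mul_one]; abel
    simp only [Set.mem_ofPred_eq] at ha hb ⊢
    rw [this]
    exact add_mem (mul_mem_baseChange I _ _ hb) ha
  inv_mem' {a} ha := by
    have h1 : grp τ a⁻¹ * grp τ a = 1 := by rw [← map_mul, inv_mul_cancel, map_one]
    have : grp τ a⁻¹ - 1 = - (grp τ a⁻¹ * (grp τ a - 1)) := by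
      rw [mul_sub, mul_one, h1]; abel
    simp only [Set.mem_ofPred_eq] at ha ⊢
    rw [this]
    exact neg_mem (mul_mem_baseChange I _ _ ha)

/-- The left ideal `H (H')⁺` of `H` attached to a subgroup `V` of `N`, where
`H' = {h ∈ H | 1 ⊗ h ∈ E[V]}` is the part of `E[V] ⊆ E[N] ≅ E ⊗ H` defined over `K` and
`(H')⁺ = H' ∩ ker ε`. -/
def idealOfSubgroup (τ : E ⊗[K] H ≃ₐc[E] MonoidAlgebra E N) (V : Subgroup N) : Ideal H :=
  Ideal.span {h | (1 : E) ⊗ₜ[K] h ∈ Submodule.span E (grp τ '' (V : Set N)) ∧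
    Coalgebra.counit (R := K) h = 0}

end Group

/-! ### The right action of `N` on `G/G'` -/

section Perm

variable {K H L E N : Type*} [Field K] [Ring H] [Bialgebra K H] [Field L] [Algebra K L]
  [Module H L] [IsScalarTower K H L] [Field E] [Algebra K E] [Group N]

lemma tensorAct_mul_apply (f : L →ₗ[K] E) (u v : E ⊗[K] H) :
    tensorAct H f (u * v) = tensorAct H (tensorAct H f u) v := by
  ext x
  induction u with
  | zero =>
    have : tensorAct H (0 : L →ₗ[K] E) v x = 0 := by
      induction v with
      | zero => simp
      | add a b ha hb => simp [ha, hb]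
      | tmul => simp
    simp [this]
  | add a b ha hb =>
    rw [add_mul, map_add, LinearMap.add_apply, ha, hb, map_add]
    clear ha hb
    induction v with
    | zero => simp
    | add c d hc hd => simp only [map_add, LinearMap.add_apply] at *; rw [← hc, ← hd]; ring
    | tmul => simp [mul_add]
  | tmul y h =>
    induction v with
    | zero => simp
    | add c d hc hd => simp only [mul_add, map_add, LinearMap.add_apply] at *; rw [hc, hd]
    | tmul z k => simp [mul_smul]; ring

lemma tensorAct_one (f : L →ₗ[K] E) : tensorAct H f 1 = f := by
  ext x
  simp [Algebra.TensorProduct.one_def]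

lemma tensorAct_map_one (hL : IsModuleAlgebra K H L) (f : L →ₐ[K] E) (u : E ⊗[K] H) :
    tensorAct H f.toLinearMap u 1 = Coalgebra.counit (R := E) u := by
  induction u with
  | zero => simp
  | add a b ha hb => simp [ha, hb]
  | tmul y h => simp [hL.smul_one, Algebra.smul_def, mul_comm]

lemma tensorAct_map_mul (hL : IsModuleAlgebra K H L) (f : L →ₐ[K] E) (u : E ⊗[K] H) (x y : L) :
    tensorAct H f.toLinearMap u (x * y) =
      LinearMap.mul' E E (TensorProduct.map
        ((LinearMap.applyₗ' E x).comp (tensorAct H f.toLinearMap))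
        ((LinearMap.applyₗ' E y).comp (tensorAct H f.toLinearMap))
        (Coalgebra.comul (R := E) u)) := by
  induction u with
  | zero => simp
  | add a b ha hb => simp only [map_add, LinearMap.add_apply, ha, hb]
  | tmul z h =>
    simp only [tensorAct_tmul, hL.smul_mul, TensorProduct.comul_tmul, CommSemiring.comul_apply]
    induction Coalgebra.comul (R := K) h with
    | zero => simp
    | add a b ha hb => simp only [TensorProduct.tmul_add, map_add, mul_add, ha, hb]
    | tmul a b => simp [orbitMap]; ring

/-- The embedding `f · n : L → E`, for an embedding `f : L → E` and `n ∈ N ⊆ E ⊗ H`. -/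
def embAct (hL : IsModuleAlgebra K H L) (τ : E ⊗[K] H ≃ₐc[E] MonoidAlgebra E N)
    (f : L →ₐ[K] E) (n : N) : L →ₐ[K] E :=
  AlgHom.ofLinearMap (tensorAct H f.toLinearMap (grp τ n))
    (by rw [tensorAct_map_one hL, (isGroupLikeElem_grp τ n).counit_eq_one])
    (fun x y => by
      rw [tensorAct_map_mul hL, (isGroupLikeElem_grp τ n).comul_eq_tmul_self]
      simp)

lemma embAct_one (hL : IsModuleAlgebra K H L) (τ : E ⊗[K] H ≃ₐc[E] MonoidAlgebra E N)
    (f : L →ₐ[K] E) : embAct hL τ f 1 = f := by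
  ext x
  simp [embAct, tensorAct_one]

lemma embAct_mul (hL : IsModuleAlgebra K H L) (τ : E ⊗[K] H ≃ₐc[E] MonoidAlgebra E N)
    (f : L →ₐ[K] E) (m n : N) : embAct hL τ f (m * n) = embAct hL τ (embAct hL τ f m) n := by
  ext x
  simp [embAct, tensorAct_mul_apply]

/-- The right action of `N` on the set of `K`-embeddings `L → E`. -/
def embPerm (hL : IsModuleAlgebra K H L) (τ : E ⊗[K] H ≃ₐc[E] MonoidAlgebra E N) :
    Nᵐᵒᵖ →* Equiv.Perm (L →ₐ[K] E) where
  toFun n :=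
    { toFun := fun f => embAct hL τ f n.unop
      invFun := fun f => embAct hL τ f n.unop⁻¹
      left_inv := fun f => by simp only [← embAct_mul, mul_inv_cancel, embAct_one]
      right_inv := fun f => by simp only [← embAct_mul, inv_mul_cancel, embAct_one] }
  map_one' := by ext1 f; exact embAct_one hL τ f
  map_mul' m n := by ext1 f; exact embAct_mul hL τ f n.unop m.unop

variable [Algebra L E] [IsScalarTower K L E]

/-- `G' = Gal(E/L)` as a subgroup of `G = Gal(E/K)`. -/
def galSub (K L E : Type*) [Field K] [Field L] [Algebra K L] [Field E] [Algebra K E] [Algebra L E]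
    [IsScalarTower K L E] : Subgroup Gal(E/K) :=
  (IsScalarTower.toAlgHom K L E).fieldRange.fixingSubgroup

lemma mem_galSub {g : Gal(E/K)} :
    g ∈ galSub K L E ↔ ∀ x : L, g (algebraMap L E x) = algebraMap L E x := by
  simp [galSub, IntermediateField.mem_fixingSubgroup_iff]

/-- The map `G/G' → Hom_{K-Alg}(L, E)`, `gG' ↦ g|_L`. -/
def cosetToEmb (K L E : Type*) [Field K] [Field L] [Algebra K L] [Field E] [Algebra K E]
    [Algebra L E] [IsScalarTower K L E] : Gal(E/K) ⧸ galSub K L E → (L →ₐ[K] E) :=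
  Quotient.lift (fun g : Gal(E/K) => (g : E →ₐ[K] E).comp (IsScalarTower.toAlgHom K L E))
    (fun a b hab => by
      have h := mem_galSub.1 (QuotientGroup.leftRel_apply.1 hab)
      ext x
      have := congrArg a (h x)
      simpa [AlgEquiv.mul_apply, ← AlgEquiv.mul_apply a a⁻¹] using this.symm)

lemma cosetToEmb_bijective [Normal K E] : Function.Bijective (cosetToEmb K L E) := by
  constructor
  · rintro ⟨a⟩ ⟨b⟩ hab
    refine Quotient.sound (QuotientGroup.leftRel_apply.2 (mem_galSub.2 fun x => ?_))
    have h : a (algebraMap L E x) = b (algebraMap L E x) := DFunLike.congr_fun hab x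
    rw [AlgEquiv.mul_apply, ← h, ← AlgEquiv.mul_apply, inv_mul_cancel, AlgEquiv.one_apply]
  · intro f
    let e : L ≃ₐ[K] f.fieldRange := AlgEquiv.ofInjectiveField f
    refine ⟨QuotientGroup.mk (e.liftNormal E), ?_⟩
    ext x
    exact e.liftNormal_commutes E x

/-- The bijection `G/G' ≅ Hom_{K-Alg}(L, E)`, `gG' ↦ g|_L`, for `E` a normal closure of `L/K`. -/
def cosetEquiv (K L E : Type*) [Field K] [Field L] [Algebra K L] [Field E] [Algebra K E]
    [Algebra L E] [IsScalarTower K L E] [IsNormalClosure K L E] :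
    Gal(E/K) ⧸ galSub K L E ≃ (L →ₐ[K] E) :=
  haveI : Normal K E := IsNormalClosure.normal (K := L)
  Equiv.ofBijective (cosetToEmb K L E) cosetToEmb_bijective

/-- The right action of `N` on `G/G' ≅ Hom_{K-Alg}(L, E)`, as a homomorphism from the opposite
group of `N` to `Perm(G/G')`. -/
def rightPerm [IsNormalClosure K L E] (hL : IsModuleAlgebra K H L)
    (τ : E ⊗[K] H ≃ₐc[E] MonoidAlgebra E N) :
    Nᵐᵒᵖ →* Equiv.Perm (Gal(E/K) ⧸ galSub K L E) :=
  ((cosetEquiv K L E).symm.permCongrHom.toMonoidHom).comp (embPerm hL τ)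

/-- The group `λ(G) ⊆ Perm(G/G')` of left translations. -/
def leftTranslations (K L E : Type*) [Field K] [Field L] [Algebra K L] [Field E] [Algebra K E]
    [Algebra L E] [IsScalarTower K L E] : Subgroup (Equiv.Perm (Gal(E/K) ⧸ galSub K L E)) :=
  (MulAction.toPermHom Gal(E/K) (Gal(E/K) ⧸ galSub K L E)).range

end Perm

end HopfGalois

end

/-!
The proof replaces the base change `E ⊗ L`, with its action of `E ⊗ H`, by the finite set `X` of
embeddings `L → E`, on which `Gal(E/K)` acts from the left and `N` from the right.

*The group `N`.* Each embedding `f` gives an `E`-linear map `u ↦ f · u` from `E ⊗ H` to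
`Hom_K(L, E)`, which is bijective because the canonical map is (`tensorAct_bijective`). An element
`u` is group-like if and only if `f · u` is again an embedding, so the group-like elements of
`E ⊗ H` act simply transitively on `X`. Hence they form a group, although `H` is only assumed to be
a bialgebra, and, since there are `[L : K]` of them and they are linearly independent, they are a
basis of `E ⊗ H` (`exists_group_equiv`). For any `N` and `τ`, the group `N` likewise acts simply
transitively on `X`, and `g (f · n) = (g f) · (g · n)` for `g ∈ Gal(E/K)` (`embAct_galAct`). This
identity says that `λ(g)` conjugates the permutation given by `n` to the one given by `g · n`, which
is the statement about normalizers.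

*From fields to subgroups.* By Galois descent (`le_baseChange_of_galTensor_mem`), `E ⊗ J(L₀)` is the
common kernel of the maps `u ↦ (f · u)|_{L₀}`, so the subgroup attached to `L₀` consists of the `n`
with `f · n = f` on `L₀` for all `f`. A dimension count shows that `L₀` is an `H`-subextension if
and only if a single `f` already has kernel `E ⊗ J(L₀)`. By the linear independence of embeddings
this means that, for each `f`, every `n` with `f · n = f` on `L₀` lies in the subgroup attached to `L₀`
(`isHSubextension_iff_forall_embAct`).

*From subgroups to fields.* Again by descent, the invariants of the ideal attached to an equivariant
subgroup `V` are the `x` with `(f · v)(x) = f(x)` for all `f` and all `v ∈ V`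
(`coe_fixedBy_eq_invariants`). With `ι : L → E` the inclusion, equivariance makes
`{g ∈ Gal(E/K) | g ι ∈ ι · V}` a subgroup containing `Gal(E/L)`, whose fixed field is the image of
this set of invariants. The correspondence is therefore reduced to classical Galois theory of `E/K`.

*Normality.* The field fixed by `V` is `H`-stable if and only if `(f · v n)(x) = (f · n)(x)` for `x`
in it and all `f`, `v ∈ V`, `n ∈ N`, because `N` spans `E ⊗ H`; and `v n = n (n⁻¹ v n)`.
-/

noncomputable section

namespace HopfGalois

/-! ### The canonical map extended along an embedding -/

section Canonical

variable {K H L E : Type*} [Field K] [Ring H] [Bialgebra K H] [Field L] [Algebra K L]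
  [Module H L] [IsScalarTower K H L] [Field E] [Algebra K E]

lemma finrank_eq_of_isHopfGalois [FiniteDimensional K L] [FiniteDimensional K H]
    (hHG : IsHopfGalois K H L) :
    Module.finrank K H = Module.finrank K L := by
  have h := (LinearEquiv.ofBijective _ hHG.bijective_can).finrank_eq
  rwa [Module.finrank_baseChange, Module.finrank_linearMap_self] at h

lemma tensorAct_comp {F : Type*} [Field F] [Algebra K F] (f : L →ₗ[K] E) (g : E →ₐ[K] F)
    (u : E ⊗[K] H) (x : L) :
    tensorAct H (g.toLinearMap ∘ₗ f) (Algebra.TensorProduct.map g (AlgHom.id K H) u) x =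
      g (tensorAct H f u x) := by
  induction u with
  | zero => simp
  | add a b ha hb => simp only [map_add, LinearMap.add_apply, ha, hb]
  | tmul y h => simp

lemma tensorAct_galTensor (f : L →ₐ[K] E) (g : Gal(E/K)) (u : E ⊗[K] H) (x : L) :
    tensorAct H ((g : E →ₐ[K] E).comp f).toLinearMap (galTensor H g u) x =
      g (tensorAct H f.toLinearMap u x) :=
  tensorAct_comp f.toLinearMap (g : E →ₐ[K] E) u x

/-- The surjectivity of the canonical map, extended from `L` to `E` along an embedding `f`:
`Hom_K(L, E)` is spanned over `E` by the composites of `f` with endomorphisms of `L`. -/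
lemma tensorAct_surjective [FiniteDimensional K L] (hHG : IsHopfGalois K H L) (f : L →ₐ[K] E) :
    Function.Surjective (tensorAct H f.toLinearMap) := by
  intro φ
  let b := Module.finBasis K L
  have h1 : ∀ T : L →ₗ[K] L, ∃ u, tensorAct H f.toLinearMap u = f.toLinearMap ∘ₗ T := by
    intro T
    obtain ⟨t, rfl⟩ := hHG.bijective_can.2 T
    refine ⟨Algebra.TensorProduct.map f (AlgHom.id K H) t, ?_⟩
    ext x
    exact tensorAct_comp LinearMap.id f t x
  choose w hw using h1
  -- `φ = ∑ i, φ(bᵢ) (f ∘ bᵢ*)`, with the coordinate form `bᵢ*` viewed as a map `L → L`.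
  refine ⟨∑ i, φ (b i) • w ((b.coord i).smulRight 1), b.ext fun j => ?_⟩
  simp [hw, Finsupp.single_apply, apply_ite f]

lemma tensorAct_bijective [FiniteDimensional K L] [FiniteDimensional K H]
    (hHG : IsHopfGalois K H L) (f : L →ₐ[K] E) :
    Function.Bijective (tensorAct H f.toLinearMap) := by
  have hs := tensorAct_surjective (H := H) hHG f
  refine ⟨(LinearMap.injective_iff_surjective_of_finrank_eq_finrank ?_).2 hs, hs⟩
  rw [Module.finrank_baseChange, Module.finrank_linearMap_self, finrank_eq_of_isHopfGalois hHG]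

/-- The converse of the construction of `embAct`: a product of two evaluations of `f · u` is read
off from `u ⊗ u`, its evaluation at a product from the comultiplication of `u`, and the pairs of
evaluations separate the points of `(E ⊗ H) ⊗ (E ⊗ H)`. -/
lemma isGroupLikeElem_of_tensorAct_eq [FiniteDimensional K L] [FiniteDimensional K H]
    (hHG : IsHopfGalois K H L) (f f' : L →ₐ[K] E) {u : E ⊗[K] H}
    (hu : tensorAct H f.toLinearMap u = f'.toLinearMap) : IsGroupLikeElem E u where
  counit_eq_one := by rw [← tensorAct_map_one hHG.isModuleAlgebra f, hu]; simp
  comul_eq_tmul_self := by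
    let b := Module.finBasis K L
    -- The basis of `E ⊗ H` dual to the evaluations of `f · u` at a basis of `L`.
    let c : Module.Basis (Fin (Module.finrank K L)) E (E ⊗[K] H) :=
      .ofEquivFun ((LinearEquiv.ofBijective _ (tensorAct_bijective hHG f)).trans
        (b.constr E (M' := E)).symm)
    have hc : ∀ v i, c.repr v i = tensorAct H f.toLinearMap v (b i) := fun v i => by
      simp [c, Module.Basis.constr_symm_apply]
    have hev : ∀ (t : (E ⊗[K] H) ⊗[E] (E ⊗[K] H)) i j, (c.tensorProduct c).repr t (i, j) =
        LinearMap.mul' E E (TensorProduct.map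
          ((LinearMap.applyₗ' E (b i)).comp (tensorAct H f.toLinearMap))
          ((LinearMap.applyₗ' E (b j)).comp (tensorAct H f.toLinearMap)) t) := by
      intro t i j
      induction t with
      | zero => simp
      | add s t hs ht => simp only [map_add, Finsupp.add_apply, hs, ht]
      | tmul v w => simp [hc, mul_comm]
    refine (c.tensorProduct c).ext_elem fun ⟨i, j⟩ => ?_
    rw [hev, hev, ← tensorAct_map_mul hHG.isModuleAlgebra, hu]
    simp [hu]

end Canonical

/-! ### Normal closures of separable extensions -/

section Closure

/-- A normal closure of a finite separable extension is finite Galois: it is generated by roots of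
the separable polynomials `minpoly K x`, `x ∈ L`. -/
lemma finiteDimensional_isGalois_of_isNormalClosure (K L E : Type*) [Field K] [Field L]
    [Algebra K L] [FiniteDimensional K L] [Algebra.IsSeparable K L] [Field E] [Algebra K E]
    [Algebra L E] [IsScalarTower K L E] [IsNormalClosure K L E] :
    FiniteDimensional K E ∧ IsGalois K E := by
  have : Normal K E := IsNormalClosure.normal (K := L)
  let e := IsNormalClosure.equiv (F := K) (K := L) (L := E)
    (L' := IntermediateField.normalClosure K L (AlgebraicClosure L))
  refine ⟨e.symm.toLinearEquiv.finiteDimensional,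
    { to_isSeparable := (separableClosure.eq_top_iff K E).1 (top_unique ?_) }⟩
  rw [← IsNormalClosure.adjoin_rootSet (F := K) (K := L) (L := E)]
  refine iSup_le fun x => IntermediateField.adjoin_le_iff.2 fun y hy =>
    mem_separableClosure_iff.2 ?_
  exact (Algebra.IsSeparable.isSeparable K x).of_dvd
    (minpoly.dvd K y (Polynomial.aeval_eq_zero_of_mem_rootSet hy))

end Closure

/-! ### The group of group-like elements -/

section Existence

variable {K H L E : Type*} [Field K] [Ring H] [Bialgebra K H] [Field L] [Algebra K L]
  [Module H L] [IsScalarTower K H L] [Field E] [Algebra K E]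
  [FiniteDimensional K L] [FiniteDimensional K H]

/-- For a fixed embedding `f : L → E`, the bijection `u ↦ f · u` between the group-like elements of
`E ⊗ H` and the embeddings of `L` into `E`. -/
def groupLikeEquiv (hHG : IsHopfGalois K H L) (f : L →ₐ[K] E) :
    GroupLike E (E ⊗[K] H) ≃ (L →ₐ[K] E) :=
  Equiv.ofBijective
    (fun u => AlgHom.ofLinearMap (tensorAct H f.toLinearMap u.val)
      (by rw [tensorAct_map_one hHG.isModuleAlgebra, u.2.counit_eq_one])
      (fun x y => by
        rw [tensorAct_map_mul hHG.isModuleAlgebra, u.2.comul_eq_tmul_self]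
        simp))
    ⟨fun u v h => GroupLike.val_injective <| (tensorAct_bijective hHG f).1 <|
        congrArg AlgHom.toLinearMap h,
      fun f' => by
        obtain ⟨u, hu⟩ := (tensorAct_bijective hHG f).2 f'.toLinearMap
        exact ⟨⟨u, isGroupLikeElem_of_tensorAct_eq hHG f f' hu⟩, AlgHom.toLinearMap_injective hu⟩⟩

lemma toLinearMap_groupLikeEquiv (hHG : IsHopfGalois K H L) (f : L →ₐ[K] E)
    (u : GroupLike E (E ⊗[K] H)) :
    (groupLikeEquiv hHG f u).toLinearMap = tensorAct H f.toLinearMap u.val := rfl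

/-- The group-like elements of `E ⊗ H` are invertible because they act simply transitively on the
embeddings of `L` into `E`; no antipode is needed. -/
lemma isUnit_groupLike (hHG : IsHopfGalois K H L) (f : L →ₐ[K] E)
    (u : GroupLike E (E ⊗[K] H)) : IsUnit u := by
  have hr : ∀ u : GroupLike E (E ⊗[K] H), ∃ v, u * v = 1 := fun u => by
    obtain ⟨v, hv⟩ := (groupLikeEquiv hHG (groupLikeEquiv hHG f u)).surjective f
    refine ⟨v, (groupLikeEquiv hHG f).injective (AlgHom.toLinearMap_injective ?_)⟩
    rw [toLinearMap_groupLikeEquiv, GroupLike.val_mul, tensorAct_mul_apply,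
      ← toLinearMap_groupLikeEquiv hHG f, ← toLinearMap_groupLikeEquiv hHG, hv,
      toLinearMap_groupLikeEquiv, GroupLike.val_one, tensorAct_one]
  obtain ⟨v, hv⟩ := hr u
  obtain ⟨w, hw⟩ := hr v
  have : u = w := by rw [← mul_one u, ← hw, ← mul_assoc, hv, one_mul]
  exact ⟨⟨u, v, hv, this ▸ hw⟩, rfl⟩

/-- The group-like elements of `E ⊗ H` form a group of order `[L : K]` and a basis of `E ⊗ H`. -/
lemma exists_group_equiv (hHG : IsHopfGalois K H L) (f : L →ₐ[K] E)
    (hX : Nat.card (L →ₐ[K] E) = Module.finrank K L) :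
    ∃ (N : Type*) (_ : Group N), Nat.card N = Module.finrank K L ∧
      Nonempty (E ⊗[K] H ≃ₐc[E] MonoidAlgebra E N) := by
  have : Finite (GroupLike E (E ⊗[K] H)) := .of_equiv _ (groupLikeEquiv hHG f).symm
  have hcard : Nat.card (GroupLike E (E ⊗[K] H)) = Module.finrank K L :=
    (Nat.card_congr (groupLikeEquiv hHG f)).trans hX
  have := Fintype.ofFinite (GroupLike E (E ⊗[K] H))
  let c : Module.Basis (GroupLike E (E ⊗[K] H)) E (E ⊗[K] H) :=
    basisOfLinearIndependentOfCardEqFinrank linearIndep_groupLikeVal (by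
      rw [← Nat.card_eq_fintype_card, hcard, Module.finrank_baseChange,
        finrank_eq_of_isHopfGalois hHG])
  have hbij : Function.Bijective
      (MonoidAlgebra.liftGroupLikeBialgHom (R := E) (A := E ⊗[K] H)) := by
    let e := (MonoidAlgebra.basis (GroupLike E (E ⊗[K] H)) E).equiv c (.refl _)
    have h : e.toLinearMap =
        (MonoidAlgebra.liftGroupLikeBialgHom (R := E) (A := E ⊗[K] H) : _ →ₐ[E] _).toLinearMap :=
      (MonoidAlgebra.basis _ E).ext fun u => by
        rw [LinearEquiv.coe_coe, Module.Basis.equiv_apply]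
        simp [c]
    have h' : ⇑e = MonoidAlgebra.liftGroupLikeBialgHom (R := E) (A := E ⊗[K] H) :=
      funext fun x => LinearMap.congr_fun h x
    exact h' ▸ e.bijective
  let e : (GroupLike E (E ⊗[K] H))ˣ ≃* GroupLike E (E ⊗[K] H) :=
    MulEquiv.ofBijective (Units.coeHom _) ⟨Units.val_injective, isUnit_groupLike hHG f⟩
  -- The group is finite, so it has a copy in every universe.
  refine ⟨Shrink (GroupLike E (E ⊗[K] H))ˣ, inferInstance, ?_, ⟨?_⟩⟩
  · rw [← hcard]
    exact Nat.card_congr (Shrink.mulEquiv.trans e).toEquiv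
  · exact (BialgEquiv.ofBijective _ hbij).symm.trans
      (MonoidAlgebra.domCongrBialgEquiv E E (Shrink.mulEquiv.trans e).symm)

end Existence

/-! ### Galois descent for subspaces of `E ⊗ H` -/

section Descent

variable {K H E : Type*} [Field K] [Ring H] [Bialgebra K H] [Field E] [Algebra K E]
  [FiniteDimensional K E] [IsGalois K E]

/-- The trace `E ⊗ H → H`, `y ⊗ h ↦ Tr(y) h`. -/
def tensorTrace (K H E : Type*) [Field K] [Ring H] [Bialgebra K H] [Field E] [Algebra K E] :
    E ⊗[K] H →ₗ[K] H :=
  TensorProduct.lid K H ∘ₗ (Algebra.trace K E).rTensor H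

lemma one_tmul_tensorTrace (u : E ⊗[K] H) :
    (1 : E) ⊗ₜ[K] tensorTrace K H E u = ∑ g : Gal(E/K), galTensor H g u := by
  induction u with
  | zero => simp
  | add a b ha hb => simp only [map_add, TensorProduct.tmul_add, ha, hb, Finset.sum_add_distrib]
  | tmul y h =>
    simp only [galTensor_tmul, ← TensorProduct.sum_tmul, ← trace_eq_sum_automorphisms]
    simp [tensorTrace, Algebra.algebraMap_eq_smul_one, TensorProduct.smul_tmul]

/-- An element of `E ⊗ H` is recovered from the traces of its multiples, by means of a basis of `E`
and its dual basis for the trace form. -/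
lemma sum_traceDual_smul_tensorTrace {ι : Type*} [Fintype ι] [DecidableEq ι]
    (b : Module.Basis ι K E) (u : E ⊗[K] H) :
    ∑ i, b.traceDual i • ((1 : E) ⊗ₜ[K] tensorTrace K H E (b i • u)) = u := by
  induction u with
  | zero => simp
  | add a b ha hb =>
    simp only [smul_add, map_add, TensorProduct.tmul_add, Finset.sum_add_distrib, ha, hb]
  | tmul y h =>
    conv_rhs => rw [← b.traceDual.sum_repr y, TensorProduct.sum_tmul]
    refine Finset.sum_congr rfl fun i _ => ?_
    simp [tensorTrace, TensorProduct.smul_tmul', Module.Basis.traceDual_repr_apply,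
      Algebra.traceForm_apply, mul_comm y]

/-- Galois descent for subspaces: an `E`-subspace of `E ⊗ H` that is stable under `Gal(E/K)` is
spanned by the elements of `H` it contains. -/
lemma le_baseChange_of_galTensor_mem (W : Submodule E (E ⊗[K] H))
    (hW : ∀ g : Gal(E/K), ∀ u ∈ W, galTensor H g u ∈ W) :
    W ≤ ((W.restrictScalars K).comap (TensorProduct.mk K E H 1)).baseChange E := by
  classical
  intro u hu
  rw [← sum_traceDual_smul_tensorTrace (Module.finBasis K E) u]
  refine sum_mem fun i _ => Submodule.smul_mem _ _ (Submodule.tmul_mem_baseChange_of_mem _ ?_)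
  rw [Submodule.mem_comap, TensorProduct.mk_apply, one_tmul_tensorTrace]
  exact sum_mem fun g _ => hW g _ (W.smul_mem _ hu)

end Descent

/-! ### Subextensions and the annihilator -/

section Subextension

variable {K H L E : Type*} [Field K] [Ring H] [Bialgebra K H] [Field L] [Algebra K L]
  [Module H L] [IsScalarTower K H L] [Field E] [Algebra K E]

/-- The `E`-linear map `E ⊗ H → Hom_K(L₀, E)`, `u ↦ (f · u)|_{L₀}`. -/
def resAct (H : Type*) {K L E : Type*} [Field K] [Ring H] [Bialgebra K H] [Field L]
    [Algebra K L] [Module H L] [IsScalarTower K H L] [Field E] [Algebra K E]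
    (L₀ : IntermediateField K L) (f : L →ₐ[K] E) : E ⊗[K] H →ₗ[E] (L₀ →ₗ[K] E) :=
  LinearMap.lcomp E E L₀.val.toLinearMap ∘ₗ tensorAct H f.toLinearMap

lemma resAct_apply (L₀ : IntermediateField K L) (f : L →ₐ[K] E) (u : E ⊗[K] H) (x : L₀) :
    resAct H L₀ f u x = tensorAct H f.toLinearMap u x := rfl

lemma resAct_surjective [FiniteDimensional K L] (hHG : IsHopfGalois K H L)
    (L₀ : IntermediateField K L) (f : L →ₐ[K] E) : Function.Surjective (resAct H L₀ f) := by
  intro φ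
  obtain ⟨ψ, hψ⟩ := LinearMap.exists_extend (p := L₀.toSubalgebra.toSubmodule) φ
  obtain ⟨u, hu⟩ := tensorAct_surjective (H := H) hHG f ψ
  refine ⟨u, ?_⟩
  rw [← hψ, resAct, LinearMap.comp_apply, hu]
  rfl

/-- The map `E ⊗ H/J(L₀) → Hom_K(L₀, E)` through which `resAct` factors. For the identity of `L`
it is the canonical map that defines `H`-subextensions. -/
def resQuot (H : Type*) {K L E : Type*} [Field K] [Ring H] [Bialgebra K H] [Field L]
    [Algebra K L] [Module H L] [IsScalarTower K H L] [Field E] [Algebra K E]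
    (L₀ : IntermediateField K L) (f : L →ₐ[K] E) :
    E ⊗[K] (H ⧸ (annihilator H L₀).restrictScalars K) →ₗ[E] (L₀ →ₗ[K] E) :=
  LinearMap.liftBaseChange E
    (((annihilator H L₀).restrictScalars K).liftQ
      (LinearMap.lcomp K E L₀.val.toLinearMap ∘ₗ actHom H f.toLinearMap)
      (fun h hh => by
        rw [LinearMap.mem_ker]
        ext x
        exact (congrArg f (hh x x.2)).trans (map_zero f)))

lemma resQuot_baseChange_mkQ (L₀ : IntermediateField K L) (f : L →ₐ[K] E) (u : E ⊗[K] H) :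
    resQuot H L₀ f (((annihilator H L₀).restrictScalars K).mkQ.baseChange E u) =
      resAct H L₀ f u := by
  induction u with
  | zero => simp
  | add a b ha hb => simp only [map_add, ha, hb]
  | tmul y h => ext x; simp [resQuot, resAct, actHom]

lemma baseChange_mkQ_surjective (J : Submodule K H) :
    Function.Surjective (J.mkQ.baseChange E) :=
  LinearMap.lTensor_surjective E J.mkQ_surjective

lemma baseChange_mkQ_eq_zero_iff (J : Submodule K H) (u : E ⊗[K] H) :
    J.mkQ.baseChange E u = 0 ↔ u ∈ J.baseChange E := by
  have h := SetLike.ext_iff.1 (lTensor_mkQ E J) u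
  rw [LinearMap.mem_ker, LinearMap.mem_range] at h
  exact h

lemma resQuot_surjective [FiniteDimensional K L] (hHG : IsHopfGalois K H L)
    (L₀ : IntermediateField K L) (f : L →ₐ[K] E) : Function.Surjective (resQuot H L₀ f) :=
  fun φ => by
    obtain ⟨u, rfl⟩ := resAct_surjective (H := H) hHG L₀ f φ
    exact ⟨_, resQuot_baseChange_mkQ L₀ f u⟩

lemma resQuot_injective_iff_finrank [FiniteDimensional K L] [FiniteDimensional K H]
    (hHG : IsHopfGalois K H L) (L₀ : IntermediateField K L) (f : L →ₐ[K] E) :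
    Function.Injective (resQuot H L₀ f) ↔
      Module.finrank K (H ⧸ (annihilator H L₀).restrictScalars K) = Module.finrank K L₀ := by
  rw [← Module.finrank_baseChange (R := E), ← Module.finrank_linearMap_self K E L₀]
  have hs := resQuot_surjective (H := H) hHG L₀ f
  exact ⟨fun hi => (LinearEquiv.ofBijective _ ⟨hi, hs⟩).finrank_eq,
    fun h => (LinearMap.injective_iff_surjective_of_finrank_eq_finrank h).2 hs⟩

/-- `L₀` is an `H`-subextension if and only if, for one or equivalently any embedding `f : L → E`,
the kernel of `u ↦ (f · u)|_{L₀}` is no larger than `E ⊗ J(L₀)`. Both amount to the dimension of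
`H/J(L₀)` being the degree of `L₀`. -/
lemma isHSubextension_iff_ker_resAct_le [FiniteDimensional K L] [FiniteDimensional K H]
    (hHG : IsHopfGalois K H L) (L₀ : IntermediateField K L) (f : L →ₐ[K] E) :
    IsHSubextension H L₀ ↔ LinearMap.ker (resAct H L₀ f) ≤
      ((annihilator H L₀).restrictScalars K).baseChange E := by
  have hsurj := resQuot_surjective (H := H) hHG L₀ (AlgHom.id K L)
  calc IsHSubextension H L₀ ↔ Function.Injective (resQuot H L₀ (AlgHom.id K L)) :=
        ⟨fun h => h.1, fun h => ⟨h, hsurj⟩⟩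
    _ ↔ Function.Injective (resQuot H L₀ f) := by
        rw [resQuot_injective_iff_finrank hHG, resQuot_injective_iff_finrank hHG]
    _ ↔ _ := by
        rw [injective_iff_map_eq_zero, (baseChange_mkQ_surjective _).forall]
        simp only [resQuot_baseChange_mkQ, baseChange_mkQ_eq_zero_iff]
        rfl

variable [FiniteDimensional K E] [IsGalois K E]

/-- The subspace `E ⊗ J(L₀)` is the common kernel of the maps `u ↦ (f · u)|_{L₀}`, since this
common kernel is stable under `Gal(E/K)`. -/
lemma mem_baseChange_annihilator_iff [Nonempty (L →ₐ[K] E)] (L₀ : IntermediateField K L)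
    (u : E ⊗[K] H) :
    u ∈ ((annihilator H L₀).restrictScalars K).baseChange E ↔
      ∀ f : L →ₐ[K] E, resAct H L₀ f u = 0 := by
  constructor
  · intro hu f
    rw [← resQuot_baseChange_mkQ, (baseChange_mkQ_eq_zero_iff _ _).2 hu, map_zero]
  · intro hu
    have hmem : ∀ u, u ∈ ⨅ f : L →ₐ[K] E, LinearMap.ker (resAct H L₀ f) ↔
        ∀ f : L →ₐ[K] E, resAct H L₀ f u = 0 := by simp
    have h := le_baseChange_of_galTensor_mem (⨅ f : L →ₐ[K] E, LinearMap.ker (resAct H L₀ f))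
      (fun g u hu => (hmem _).2 fun f => by
        ext x
        have hf : ((g : E →ₐ[K] E).comp ((g.symm : E →ₐ[K] E).comp f)) = f := by ext y; simp
        have := tensorAct_galTensor ((g.symm : E →ₐ[K] E).comp f) g u x
        rw [hf] at this
        rw [resAct_apply, this, ← resAct_apply, (hmem u).1 hu]
        simp) ((hmem u).2 hu)
    refine Submodule.baseChange_mono E ?_ h
    intro h hh x hx
    obtain ⟨f⟩ := ‹Nonempty (L →ₐ[K] E)›
    have := LinearMap.congr_fun ((hmem _).1 hh f) ⟨x, hx⟩
    simpa [resAct_apply] using this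

end Subextension

/-! ### The action of `N` on the embeddings -/

section SimplyTransitive

variable {K H L E N : Type*} [Field K] [Ring H] [Bialgebra K H] [Field L] [Algebra K L]
  [Module H L] [IsScalarTower K H L] [Field E] [Algebra K E] [Group N]

lemma span_range_grp (τ : E ⊗[K] H ≃ₐc[E] MonoidAlgebra E N) :
    Submodule.span E (Set.range (grp τ)) = ⊤ := by
  rw [← ((MonoidAlgebra.basis N E).map
    (BialgEquivClass.toBialgEquiv τ.symm : MonoidAlgebra E N ≃ₗ[E] E ⊗[K] H)).span_eq]
  congr 1

lemma embAct_apply (hL : IsModuleAlgebra K H L) (τ : E ⊗[K] H ≃ₐc[E] MonoidAlgebra E N)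
    (f : L →ₐ[K] E) (n : N) (x : L) :
    embAct hL τ f n x = tensorAct H f.toLinearMap (grp τ n) x := rfl

lemma galAct_galAct_symm (τ : E ⊗[K] H ≃ₐc[E] MonoidAlgebra E N) (g : Gal(E/K)) (n : N) :
    galAct τ g (galAct τ g⁻¹ n) = n := by
  refine grp_injective τ ?_
  rw [grp_galAct, grp_galAct]
  induction grp τ n with
  | zero => simp
  | add a b ha hb => simp only [map_add, ha, hb]
  | tmul y h =>
    rw [galTensor_tmul, galTensor_tmul, ← AlgEquiv.mul_apply, mul_inv_cancel, AlgEquiv.one_apply]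

/-- The actions of `Gal(E/K)` and `N` on the embeddings of `L` are compatible:
`g (f · n) = (g f) · (g · n)`. -/
lemma embAct_galAct (hL : IsModuleAlgebra K H L) (τ : E ⊗[K] H ≃ₐc[E] MonoidAlgebra E N)
    (g : Gal(E/K)) (f : L →ₐ[K] E) (n : N) :
    embAct hL τ ((g : E →ₐ[K] E).comp f) (galAct τ g n) =
      (g : E →ₐ[K] E).comp (embAct hL τ f n) := by
  ext x
  rw [embAct_apply, grp_galAct, tensorAct_galTensor]
  rfl

/-- Two embeddings `f, f'` with `(f · n)(x) = (f' · n)(x)` for all `n ∈ N` agree on `H • x`, since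
`N` spans `E ⊗ H`. -/
lemma apply_smul_eq_of_embAct_eq (hL : IsModuleAlgebra K H L)
    (τ : E ⊗[K] H ≃ₐc[E] MonoidAlgebra E N) {f f' : L →ₐ[K] E} {x : L}
    (h : ∀ n, embAct hL τ f n x = embAct hL τ f' n x) (a : H) : f (a • x) = f' (a • x) := by
  have key : LinearMap.applyₗ' E x ∘ₗ tensorAct H f.toLinearMap =
      LinearMap.applyₗ' E x ∘ₗ tensorAct H f'.toLinearMap := by
    refine LinearMap.ext_on_range (v := grp τ) (span_range_grp τ) fun n => h n
  simpa using LinearMap.congr_fun key (1 ⊗ₜ a)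

/-- Two embeddings `f, f'` that agree on `H • x` satisfy `(f · n)(x) = (f' · n)(x)` for `n ∈ N`. -/
lemma embAct_eq_of_apply_smul_eq (hL : IsModuleAlgebra K H L)
    (τ : E ⊗[K] H ≃ₐc[E] MonoidAlgebra E N) {f f' : L →ₐ[K] E} {x : L}
    (h : ∀ a : H, f (a • x) = f' (a • x)) (n : N) : embAct hL τ f n x = embAct hL τ f' n x := by
  rw [embAct_apply, embAct_apply]
  induction grp τ n with
  | zero => simp
  | add a b ha hb => simp only [map_add, LinearMap.add_apply, ha, hb]
  | tmul y a => simp [h]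

section Transitive

variable [FiniteDimensional K L] [FiniteDimensional K H]

lemma embAct_injective (hHG : IsHopfGalois K H L) (τ : E ⊗[K] H ≃ₐc[E] MonoidAlgebra E N)
    (f : L →ₐ[K] E) : Function.Injective (embAct hHG.isModuleAlgebra τ f) := fun _ _ h =>
  grp_injective τ <| (tensorAct_bijective hHG f).1 <| congrArg AlgHom.toLinearMap h

/-- `N` acts transitively on the embeddings of `L`: every embedding is a linear combination of
those in the orbit of `f`, and distinct embeddings are linearly independent. -/
lemma embAct_surjective (hHG : IsHopfGalois K H L) (τ : E ⊗[K] H ≃ₐc[E] MonoidAlgebra E N)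
    (f : L →ₐ[K] E) : Function.Surjective (embAct hHG.isModuleAlgebra τ f) := by
  intro f'
  by_contra hf'
  refine (linearIndependent_toLinearMap K L E).notMem_span_image
    (s := Set.range (embAct hHG.isModuleAlgebra τ f)) (x := f') hf' ?_
  obtain ⟨u, hu⟩ := (tensorAct_bijective hHG f).2 f'.toLinearMap
  have hmem : tensorAct H f.toLinearMap u ∈
      (Submodule.span E (Set.range (grp τ))).map (tensorAct H f.toLinearMap) :=
    Submodule.mem_map_of_mem (by rw [span_range_grp]; trivial)
  rw [hu, Submodule.map_span, ← Set.range_comp] at hmem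
  rw [← Set.range_comp]
  exact hmem

end Transitive

variable [FiniteDimensional K E] [IsGalois K E] [Nonempty (L →ₐ[K] E)]

lemma mem_subgroupOfIdeal_annihilator_iff (hL : IsModuleAlgebra K H L)
    (τ : E ⊗[K] H ≃ₐc[E] MonoidAlgebra E N) (L₀ : IntermediateField K L) (n : N) :
    n ∈ subgroupOfIdeal τ (annihilator H L₀) ↔
      ∀ f : L →ₐ[K] E, ∀ x ∈ L₀, embAct hL τ f n x = f x := by
  change grp τ n - 1 ∈ ((annihilator H L₀).restrictScalars K).baseChange E ↔ _
  rw [mem_baseChange_annihilator_iff]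
  refine forall_congr' fun f => ?_
  rw [LinearMap.ext_iff, Subtype.forall]
  refine forall₂_congr fun x hx => ?_
  rw [resAct_apply, map_sub, tensorAct_one, LinearMap.sub_apply, LinearMap.zero_apply, sub_eq_zero]
  rfl

lemma isGEquivariant_subgroupOfIdeal (hL : IsModuleAlgebra K H L)
    (τ : E ⊗[K] H ≃ₐc[E] MonoidAlgebra E N) (L₀ : IntermediateField K L) :
    IsGEquivariant τ (subgroupOfIdeal τ (annihilator H L₀)) := by
  intro g n hn
  rw [mem_subgroupOfIdeal_annihilator_iff hL] at hn ⊢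
  intro f x hx
  have hf : ((g : E →ₐ[K] E).comp ((g.symm : E →ₐ[K] E).comp f)) = f := by ext y; simp
  have := DFunLike.congr_fun (embAct_galAct hL τ g ((g.symm : E →ₐ[K] E).comp f) n) x
  rw [hf] at this
  rw [this]
  simp [hn _ x hx]

variable [FiniteDimensional K L] [FiniteDimensional K H]

/-- `L₀` is an `H`-subextension if and only if it does not depend on the embedding `f` which
elements of `N` satisfy `f · n = f` on `L₀`. In this case restriction to `L₀` induces, for every
`f`, the same partition of `N` by `n ↦ (f · n)|_{L₀}`, and because distinct embeddings of `L₀` are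
linearly independent, the maps `u ↦ (f · u)|_{L₀}` on `E ⊗ H` have the same kernel. -/
lemma isHSubextension_iff_forall_embAct (hHG : IsHopfGalois K H L)
    (τ : E ⊗[K] H ≃ₐc[E] MonoidAlgebra E N) (L₀ : IntermediateField K L) :
    IsHSubextension H L₀ ↔ ∀ (f : L →ₐ[K] E) (n : N),
      (∀ x ∈ L₀, embAct hHG.isModuleAlgebra τ f n x = f x) →
        n ∈ subgroupOfIdeal τ (annihilator H L₀) := by
  constructor
  · intro h f n hn
    refine (isHSubextension_iff_ker_resAct_le hHG L₀ f).1 h (LinearMap.ext fun x => ?_)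
    rw [resAct_apply, map_sub, tensorAct_one, LinearMap.sub_apply, LinearMap.zero_apply,
      sub_eq_zero]
    exact hn x x.2
  · intro h
    obtain ⟨f₀⟩ := ‹Nonempty (L →ₐ[K] E)›
    refine (isHSubextension_iff_ker_resAct_le hHG L₀ f₀).2 fun u hu =>
      (mem_baseChange_annihilator_iff L₀ u).2 fun f => ?_
    let r (f : L →ₐ[K] E) (n : N) : L₀ →ₐ[K] E :=
      (embAct hHG.isModuleAlgebra τ f n).comp L₀.val
    have hr : ∀ m n, r f₀ m = r f₀ n → r f m = r f n := by
      intro m n hmn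
      have hsplit : ∀ f' : L →ₐ[K] E, embAct hHG.isModuleAlgebra τ f' n =
          embAct hHG.isModuleAlgebra τ (embAct hHG.isModuleAlgebra τ f' m) (m⁻¹ * n) :=
        fun f' => by rw [← embAct_mul, mul_inv_cancel_left]
      have hV := h (embAct hHG.isModuleAlgebra τ f₀ m) (m⁻¹ * n) fun x hx => by
        rw [← hsplit]
        exact (DFunLike.congr_fun hmn ⟨x, hx⟩).symm
      rw [mem_subgroupOfIdeal_annihilator_iff hHG.isModuleAlgebra] at hV
      ext x
      have := hV (embAct hHG.isModuleAlgebra τ f m) x x.2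
      rw [← hsplit] at this
      exact this.symm
    classical
    -- The `E`-linear endomorphism of `Hom_K(L₀, E)` with `(f₀ · n)|_{L₀} ↦ (f · n)|_{L₀}`.
    let σ (χ : L₀ →ₐ[K] E) : L₀ →ₗ[K] E :=
      if hχ : ∃ n, r f₀ n = χ then (r f hχ.choose).toLinearMap else 0
    have hσ : ∀ n, σ (r f₀ n) = (r f n).toLinearMap := fun n => by
      have hex : ∃ m, r f₀ m = r f₀ n := ⟨n, rfl⟩
      rw [show σ (r f₀ n) = (r f hex.choose).toLinearMap from dif_pos hex,
        hr _ _ hex.choose_spec]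
    have hli := linearIndependent_toLinearMap K L₀ E
    obtain ⟨T, hT⟩ := LinearMap.exists_extend ((Module.Basis.span hli).constr E σ)
    have hTσ : ∀ χ : L₀ →ₐ[K] E, T χ.toLinearMap = σ χ := fun χ => by
      rw [← (Module.Basis.span hli).constr_basis E σ χ, ← hT, LinearMap.comp_apply,
        Submodule.subtype_apply, Module.Basis.span_apply]
    have hcomp : T ∘ₗ resAct H L₀ f₀ = resAct H L₀ f :=
      LinearMap.ext_on_range (span_range_grp τ) fun n => (hTσ (r f₀ n)).trans (hσ n)
    rw [← hcomp, LinearMap.comp_apply, LinearMap.mem_ker.1 hu, map_zero]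

end SimplyTransitive

/-! ### The field fixed by an equivariant subgroup -/

section FixedField

variable {K H L E N : Type*} [Field K] [Ring H] [Bialgebra K H] [Field L] [Algebra K L]
  [Module H L] [IsScalarTower K H L] [Field E] [Algebra K E] [Group N]

/-- The intermediate field of the `x ∈ L` with `(f · v)(x) = f(x)` for all `v ∈ V` and all
embeddings `f : L → E`; this is `L ∩ (E ⊗ L)^V` in terms of embeddings. -/
def fixedBy (hL : IsModuleAlgebra K H L) (τ : E ⊗[K] H ≃ₐc[E] MonoidAlgebra E N)
    (V : Subgroup N) : IntermediateField K L where
  carrier := {x | ∀ f : L →ₐ[K] E, ∀ v ∈ V, embAct hL τ f v x = f x}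
  mul_mem' hx hy f v hv := by rw [map_mul, map_mul, hx f v hv, hy f v hv]
  add_mem' hx hy f v hv := by rw [map_add, map_add, hx f v hv, hy f v hv]
  algebraMap_mem' c f v _ := by rw [AlgHom.commutes, AlgHom.commutes]
  inv_mem' x hx f v hv := by rw [map_inv₀, map_inv₀, hx f v hv]

lemma fixedBy_antitone (hL : IsModuleAlgebra K H L) (τ : E ⊗[K] H ≃ₐc[E] MonoidAlgebra E N) :
    Antitone (fixedBy hL τ) := fun _ _ h _ hx f v hv => hx f v (h hv)

section Invariants

lemma galTensor_mem_span_grp {τ : E ⊗[K] H ≃ₐc[E] MonoidAlgebra E N} {V : Subgroup N}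
    (hV : IsGEquivariant τ V) (g : Gal(E/K)) {u : E ⊗[K] H}
    (hu : u ∈ Submodule.span E (grp τ '' (V : Set N))) :
    galTensor H g u ∈ Submodule.span E (grp τ '' (V : Set N)) := by
  induction hu using Submodule.span_induction with
  | zero => simp
  | add a b _ _ ha hb => rw [map_add]; exact add_mem ha hb
  | smul c a _ ha => rw [galTensor_smul]; exact Submodule.smul_mem _ _ ha
  | mem a ha =>
    obtain ⟨v, hv, rfl⟩ := ha
    exact Submodule.subset_span ⟨_, hV g v hv, grp_galAct τ g v⟩

/-- On the field fixed by `V`, all of `E[V] ⊆ E ⊗ H` acts through the counit. -/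
lemma tensorAct_eq_counit_mul {hL : IsModuleAlgebra K H L}
    {τ : E ⊗[K] H ≃ₐc[E] MonoidAlgebra E N} {V : Subgroup N} {x : L} (hx : x ∈ fixedBy hL τ V)
    (f : L →ₐ[K] E) {u : E ⊗[K] H} (hu : u ∈ Submodule.span E (grp τ '' (V : Set N))) :
    tensorAct H f.toLinearMap u x = Coalgebra.counit (R := E) u * f x := by
  induction hu using Submodule.span_induction with
  | zero => simp
  | add a b _ _ ha hb => rw [map_add, LinearMap.add_apply, ha, hb, map_add, add_mul]
  | smul c a _ ha =>
    rw [map_smul, LinearMap.smul_apply, ha, map_smul, smul_eq_mul, smul_eq_mul, mul_assoc]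
  | mem a ha =>
    obtain ⟨v, hv, rfl⟩ := ha
    rw [(isGroupLikeElem_grp τ v).counit_eq_one, one_mul]
    exact hx f v hv

/-- The invariants of the ideal `H (H')⁺` attached to `V` are the elements fixed by `V`. Descent
shows that every `v - 1` with `v ∈ V` is an `E`-linear combination of elements of `(H')⁺`. -/
lemma coe_fixedBy_eq_invariants [FiniteDimensional K E] [IsGalois K E] [Nonempty (L →ₐ[K] E)]
    (hL : IsModuleAlgebra K H L) {τ : E ⊗[K] H ≃ₐc[E] MonoidAlgebra E N} {V : Subgroup N}
    (hV : IsGEquivariant τ V) :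
    (fixedBy hL τ V : Set L) = invariants K L (idealOfSubgroup τ V : Set H) := by
  ext x
  constructor
  · intro hx h hh
    suffices h • x = 0 ∧ Coalgebra.counit (R := K) h = 0 by rw [this.1, this.2, zero_smul]
    obtain ⟨f⟩ := ‹Nonempty (L →ₐ[K] E)›
    change h ∈ Ideal.span _ at hh
    induction hh using Submodule.span_induction with
    | zero => simp
    | add a b _ _ ha hb => simp [add_smul, ha, hb]
    | smul c a _ ha => simp [mul_smul, ha]
    | mem a ha =>
      refine ⟨f.injective ?_, ha.2⟩
      have := tensorAct_eq_counit_mul hx f ha.1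
      simpa [ha.2] using this
  · intro hx f v hv
    let W : Submodule E (E ⊗[K] H) := Submodule.span E (grp τ '' (V : Set N)) ⊓
      LinearMap.ker (Coalgebra.counit (R := E) (A := E ⊗[K] H))
    have hW : grp τ v - 1 ∈ W := by
      refine ⟨sub_mem (Submodule.subset_span ⟨v, hv, rfl⟩)
        (Submodule.subset_span ⟨1, V.one_mem, map_one _⟩), LinearMap.mem_ker.2 ?_⟩
      rw [map_sub, (isGroupLikeElem_grp τ v).counit_eq_one,
        Bialgebra.counit_one, sub_self]
    have key : ∀ u ∈ W, tensorAct H f.toLinearMap u x = 0 := by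
      intro u hu
      have := le_baseChange_of_galTensor_mem W (fun g w hw => ⟨galTensor_mem_span_grp hV g hw.1,
        LinearMap.mem_ker.2 <| by
          rw [counit_galTensor, LinearMap.mem_ker.1 hw.2, map_zero]⟩) hu
      rw [Submodule.baseChange_eq_span] at this
      clear hu
      induction this using Submodule.span_induction with
      | zero => simp
      | add a b _ _ ha hb => rw [map_add, LinearMap.add_apply, ha, hb, add_zero]
      | smul c a _ ha => rw [map_smul, LinearMap.smul_apply, ha, smul_zero]
      | mem a ha =>
        obtain ⟨h, hh, rfl⟩ := ha
        have h0 : Coalgebra.counit (R := K) h = 0 := by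
          have := LinearMap.mem_ker.1 hh.2
          simpa using this
        have := hx h (Ideal.subset_span ⟨hh.1, h0⟩)
        rw [h0, zero_smul] at this
        simp [this]
    have := key _ hW
    rwa [map_sub, tensorAct_one, LinearMap.sub_apply, sub_eq_zero] at this

end Invariants

section GaloisCorrespondence

variable [Algebra L E] [IsScalarTower K L E]

variable (L) in
/-- For a `Gal(E/K)`-equivariant subgroup `V` of `N` and the inclusion `ι : L → E`, the subgroup
of the `g ∈ Gal(E/K)` with `g ι ∈ ι · V`. -/
def galSubOfSubgroup (hL : IsModuleAlgebra K H L) {τ : E ⊗[K] H ≃ₐc[E] MonoidAlgebra E N}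
    {V : Subgroup N} (hV : IsGEquivariant τ V) : Subgroup Gal(E/K) where
  carrier := {g | ∃ v ∈ V, (g : E →ₐ[K] E).comp (IsScalarTower.toAlgHom K L E) =
    embAct hL τ (IsScalarTower.toAlgHom K L E) v}
  one_mem' := ⟨1, V.one_mem, by rw [embAct_one]; rfl⟩
  mul_mem' := by
    rintro a b ⟨v, hv, ha⟩ ⟨w, hw, hb⟩
    refine ⟨v * galAct τ a w, V.mul_mem hv (hV a w hw), ?_⟩
    rw [embAct_mul, ← ha, embAct_galAct, ← hb]
    rfl
  inv_mem' := by
    rintro a ⟨v, hv, ha⟩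
    refine ⟨(galAct τ a⁻¹ v)⁻¹, V.inv_mem (hV _ v hv), ?_⟩
    have h := embAct_galAct hL τ a⁻¹ (IsScalarTower.toAlgHom K L E) v
    have h1 : ((a⁻¹ : Gal(E/K)) : E →ₐ[K] E).comp
        (embAct hL τ (IsScalarTower.toAlgHom K L E) v) = IsScalarTower.toAlgHom K L E := by
      rw [← ha]
      ext x
      exact AlgEquiv.symm_apply_apply a _
    rw [h1] at h
    conv_rhs => rw [← h]
    rw [← embAct_mul, mul_inv_cancel, embAct_one]

instance nonempty_algHom_of_isScalarTower : Nonempty (L →ₐ[K] E) := ⟨IsScalarTower.toAlgHom K L E⟩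

variable [IsGalois K E]

lemma exists_comp_eq (f : L →ₐ[K] E) :
    ∃ g : Gal(E/K), (g : E →ₐ[K] E).comp (IsScalarTower.toAlgHom K L E) = f := by
  obtain ⟨q, hq⟩ := cosetToEmb_bijective.2 f
  obtain ⟨g, rfl⟩ := QuotientGroup.mk_surjective q
  exact ⟨g, hq⟩

/-- For equivariant `V`, the condition `ι · v = ι` for the single embedding `ι` already decides
which elements are fixed by `V`, since every embedding is some `a ι`, and
`(a ι) · v = a (ι · (a⁻¹ · v))`. -/
lemma mem_fixedBy_iff_mem_fixedField (hL : IsModuleAlgebra K H L)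
    {τ : E ⊗[K] H ≃ₐc[E] MonoidAlgebra E N} {V : Subgroup N} (hV : IsGEquivariant τ V) (x : L) :
    x ∈ fixedBy hL τ V ↔
      algebraMap L E x ∈ IntermediateField.fixedField (galSubOfSubgroup L hL hV) := by
  rw [IntermediateField.mem_fixedField_iff]
  constructor
  · rintro hx g ⟨v, hv, hg⟩
    exact (DFunLike.congr_fun hg x).trans (hx _ v hv)
  · intro hx f v hv
    obtain ⟨a, rfl⟩ := exists_comp_eq f
    have h1 : ∀ w ∈ V, embAct hL τ (IsScalarTower.toAlgHom K L E) w x = algebraMap L E x := by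
      intro w hw
      obtain ⟨g, hg⟩ := exists_comp_eq (embAct hL τ (IsScalarTower.toAlgHom K L E) w)
      rw [← hg]
      exact hx g ⟨w, hw, hg⟩
    rw [← galAct_galAct_symm τ a v, embAct_galAct, AlgHom.comp_apply, h1 _ (hV _ v hv)]
    rfl

variable [FiniteDimensional K E]

/-- The fixed field of `{g | g ι ∈ ι · V}` lies in `L`, as this group contains `Gal(E/L)`. -/
lemma exists_algebraMap_eq_of_mem_fixedField (hL : IsModuleAlgebra K H L)
    {τ : E ⊗[K] H ≃ₐc[E] MonoidAlgebra E N} {V : Subgroup N} (hV : IsGEquivariant τ V) {y : E}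
    (hy : y ∈ IntermediateField.fixedField (galSubOfSubgroup L hL hV)) :
    ∃ x : L, algebraMap L E x = y := by
  have hle : galSub K L E ≤ galSubOfSubgroup L hL hV := fun g hg =>
    ⟨1, V.one_mem, by
      rw [embAct_one]
      ext x
      exact mem_galSub.1 hg x⟩
  have h : y ∈ IntermediateField.fixedField (galSub K L E) :=
    (IntermediateField.mem_fixedField_iff _ _).2 fun g hg =>
      (IntermediateField.mem_fixedField_iff _ _).1 hy g (hle hg)
  rw [galSub, IsGalois.fixedField_fixingSubgroup] at h
  exact h

variable [FiniteDimensional K L] [FiniteDimensional K H]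

/-- By the Galois correspondence for `E/K`, an element of `N` that acts trivially, from some
embedding, on the field fixed by `V` lies in `V`. -/
lemma mem_of_forall_mem_fixedBy (hHG : IsHopfGalois K H L)
    {τ : E ⊗[K] H ≃ₐc[E] MonoidAlgebra E N} {V : Subgroup N} (hV : IsGEquivariant τ V)
    (f : L →ₐ[K] E) {n : N}
    (hn : ∀ x ∈ fixedBy hHG.isModuleAlgebra τ V, embAct hHG.isModuleAlgebra τ f n x = f x) :
    n ∈ V := by
  have hL := hHG.isModuleAlgebra
  have h1 : ∀ m : N, (∀ x ∈ fixedBy hL τ V,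
      embAct hL τ (IsScalarTower.toAlgHom K L E) m x = algebraMap L E x) → m ∈ V := by
    intro m hm
    obtain ⟨g, hg⟩ := exists_comp_eq (embAct hL τ (IsScalarTower.toAlgHom K L E) m)
    have hmem : g ∈ (IntermediateField.fixedField (galSubOfSubgroup L hL hV)).fixingSubgroup := by
      rw [IntermediateField.mem_fixingSubgroup_iff]
      intro y hy
      obtain ⟨x, rfl⟩ := exists_algebraMap_eq_of_mem_fixedField hL hV hy
      exact (DFunLike.congr_fun hg x).trans
        (hm x ((mem_fixedBy_iff_mem_fixedField hL hV x).2 hy))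
    rw [IntermediateField.fixingSubgroup_fixedField] at hmem
    obtain ⟨v, hv, hgv⟩ := hmem
    rwa [embAct_injective hHG τ _ (hg.symm.trans hgv)]
  obtain ⟨a, rfl⟩ := exists_comp_eq f
  rw [← galAct_galAct_symm τ a n]
  refine hV a _ (h1 _ fun x hx => a.injective ?_)
  have := hn x hx
  rw [← galAct_galAct_symm τ a n, embAct_galAct] at this
  exact this

lemma subgroupOfIdeal_annihilator_fixedBy (hHG : IsHopfGalois K H L)
    {τ : E ⊗[K] H ≃ₐc[E] MonoidAlgebra E N} {V : Subgroup N} (hV : IsGEquivariant τ V) :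
    subgroupOfIdeal τ (annihilator H (fixedBy hHG.isModuleAlgebra τ V)) = V := by
  ext n
  rw [mem_subgroupOfIdeal_annihilator_iff hHG.isModuleAlgebra]
  exact ⟨fun h => mem_of_forall_mem_fixedBy hHG hV (IsScalarTower.toAlgHom K L E) (h _),
    fun hn f x hx => hx f n hn⟩

lemma isHSubextension_fixedBy (hHG : IsHopfGalois K H L)
    {τ : E ⊗[K] H ≃ₐc[E] MonoidAlgebra E N} {V : Subgroup N} (hV : IsGEquivariant τ V) :
    IsHSubextension H (fixedBy hHG.isModuleAlgebra τ V) := by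
  rw [isHSubextension_iff_forall_embAct hHG τ, subgroupOfIdeal_annihilator_fixedBy hHG hV]
  exact fun f n => mem_of_forall_mem_fixedBy hHG hV f

/-- The automorphisms of `E` that are trivial on `L₀` send `ι` to some `ι · n` with `ι · n = ι` on
`L₀`; for an `H`-subextension such an `n` lies in the subgroup attached to `L₀`. -/
lemma fixedBy_subgroupOfIdeal_annihilator (hHG : IsHopfGalois K H L)
    (τ : E ⊗[K] H ≃ₐc[E] MonoidAlgebra E N) {L₀ : IntermediateField K L}
    (hL₀ : IsHSubextension H L₀) :
    fixedBy hHG.isModuleAlgebra τ (subgroupOfIdeal τ (annihilator H L₀)) = L₀ := by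
  refine le_antisymm (fun x hx => ?_) fun x hx f v hv =>
    (mem_subgroupOfIdeal_annihilator_iff hHG.isModuleAlgebra τ L₀ v).1 hv f x hx
  -- The image of `L₀` in `E` is the fixed field of the automorphisms that are trivial on it.
  have hfix : algebraMap L E x ∈ L₀.map (IsScalarTower.toAlgHom K L E) := by
    rw [← IsGalois.fixedField_fixingSubgroup (L₀.map (IsScalarTower.toAlgHom K L E)),
      IntermediateField.mem_fixedField_iff]
    intro g hg
    rw [IntermediateField.mem_fixingSubgroup_iff] at hg
    obtain ⟨n, hn⟩ := embAct_surjective hHG τ (IsScalarTower.toAlgHom K L E)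
      ((g : E →ₐ[K] E).comp (IsScalarTower.toAlgHom K L E))
    have hnV := (isHSubextension_iff_forall_embAct hHG τ L₀).1 hL₀
      (IsScalarTower.toAlgHom K L E) n fun y hy => by
        rw [hn]
        exact hg _ ⟨y, hy, rfl⟩
    have := hx (IsScalarTower.toAlgHom K L E) n hnV
    rw [hn] at this
    exact this
  obtain ⟨y, hy, hyx⟩ := hfix
  rwa [← (algebraMap L E).injective hyx]

/-- The field fixed by `V` is `H`-stable if and only if `(f · v n)(x) = (f · n)(x)` for all `x` in
it and all `f`, `v ∈ V`, `n ∈ N`. As `v n = n (n⁻¹ v n)`, this says that `n⁻¹ v n` fixes the field,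
that is, `n⁻¹ v n ∈ V`. -/
lemma isHStable_fixedBy_iff_normal (hHG : IsHopfGalois K H L)
    {τ : E ⊗[K] H ≃ₐc[E] MonoidAlgebra E N} {V : Subgroup N} (hV : IsGEquivariant τ V) :
    IsHStable H (fixedBy hHG.isModuleAlgebra τ V) ↔ V.Normal := by
  have hL := hHG.isModuleAlgebra
  constructor
  · refine fun hs => ⟨fun v hv n => mem_of_forall_mem_fixedBy hHG hV
      (IsScalarTower.toAlgHom K L E) fun x hx => ?_⟩
    rw [embAct_mul, embAct_mul,
      embAct_eq_of_apply_smul_eq hL τ (fun a => hs a x hx _ v hv) n⁻¹, ← embAct_mul,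
      mul_inv_cancel, embAct_one]
  · intro hn a x hx f v hv
    refine apply_smul_eq_of_embAct_eq hL τ (fun n => ?_) a
    have : v * n = n * (n⁻¹ * v * n) := by group
    rw [← embAct_mul, this, embAct_mul]
    exact hx _ _ (by simpa using hn.conj_mem v hv n⁻¹)

end GaloisCorrespondence

end FixedField

/-! ### Permutations of `G/G'` -/

section Perm

variable {K H L E N : Type*} [Field K] [Ring H] [Bialgebra K H] [Field L] [Algebra K L]
  [Module H L] [IsScalarTower K H L] [Field E] [Algebra K E] [Group N]
  [Algebra L E] [IsScalarTower K L E] [IsNormalClosure K L E]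

lemma cosetEquiv_smul (g : Gal(E/K)) (q : Gal(E/K) ⧸ galSub K L E) :
    cosetEquiv K L E (g • q) = (g : E →ₐ[K] E).comp (cosetEquiv K L E q) := by
  obtain ⟨a, rfl⟩ := QuotientGroup.mk_surjective q
  rfl

lemma cosetEquiv_rightPerm (hL : IsModuleAlgebra K H L)
    (τ : E ⊗[K] H ≃ₐc[E] MonoidAlgebra E N) (n : N) (q : Gal(E/K) ⧸ galSub K L E) :
    cosetEquiv K L E (rightPerm hL τ (.op n) q) = embAct hL τ (cosetEquiv K L E q) n :=
  (cosetEquiv K L E).apply_symm_apply _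

/-- Conjugation by the left translation `λ(g)` corresponds to the action of `g` on `N`. -/
lemma conj_rightPerm (hL : IsModuleAlgebra K H L) (τ : E ⊗[K] H ≃ₐc[E] MonoidAlgebra E N)
    (g : Gal(E/K)) (n : N) :
    MulAction.toPermHom Gal(E/K) (Gal(E/K) ⧸ galSub K L E) g * rightPerm hL τ (.op n) *
      (MulAction.toPermHom Gal(E/K) (Gal(E/K) ⧸ galSub K L E) g)⁻¹ =
        rightPerm hL τ (.op (galAct τ g n)) := by
  rw [mul_inv_eq_iff_eq_mul]
  ext1 q
  refine (cosetEquiv K L E).injective ?_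
  simp only [Equiv.Perm.mul_apply, MulAction.toPermHom_apply, MulAction.toPerm_apply,
    cosetEquiv_smul, cosetEquiv_rightPerm, embAct_galAct]

lemma rightPerm_injective [FiniteDimensional K L] [FiniteDimensional K H]
    (hHG : IsHopfGalois K H L) (τ : E ⊗[K] H ≃ₐc[E] MonoidAlgebra E N) :
    Function.Injective (rightPerm (L := L) hHG.isModuleAlgebra τ) := by
  intro m n h
  refine MulOpposite.unop_injective <|
    embAct_injective hHG τ (cosetEquiv K L E (QuotientGroup.mk 1)) ?_
  rw [← cosetEquiv_rightPerm, ← cosetEquiv_rightPerm, MulOpposite.op_unop, MulOpposite.op_unop, h]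

lemma isGEquivariant_iff_leftTranslations_le_normalizer [FiniteDimensional K L]
    [FiniteDimensional K H] (hHG : IsHopfGalois K H L)
    (τ : E ⊗[K] H ≃ₐc[E] MonoidAlgebra E N) (V : Subgroup N) :
    IsGEquivariant τ V ↔ leftTranslations K L E ≤ Subgroup.normalizer
      (V.op.map (rightPerm (L := L) hHG.isModuleAlgebra τ) :
        Set (Equiv.Perm (Gal(E/K) ⧸ galSub K L E))) := by
  have hinj := rightPerm_injective (E := E) (N := N) hHG τ
  have hmem : ∀ n : N, rightPerm (L := L) hHG.isModuleAlgebra τ (.op n) ∈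
      V.op.map (rightPerm (L := L) hHG.isModuleAlgebra τ) ↔ n ∈ V := fun n =>
    (Subgroup.mem_map_iff_mem hinj).trans Subgroup.mem_op
  constructor
  · rintro hV _ ⟨g, rfl⟩
    rw [Subgroup.mem_normalizer_iff_map_conj_eq]
    ext p
    constructor
    · rintro ⟨_, ⟨n, hn, rfl⟩, rfl⟩
      have := (hmem _).2 (hV g _ hn)
      rwa [← conj_rightPerm] at this
    · rintro ⟨n, hn, rfl⟩
      refine ⟨_, (hmem _).2 (hV g⁻¹ _ hn), ?_⟩
      refine (conj_rightPerm hHG.isModuleAlgebra τ g _).trans ?_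
      rw [galAct_galAct_symm, MulOpposite.op_unop]
  · intro h g v hv
    have hg := Subgroup.mem_normalizer_iff_map_conj_eq.1 (h ⟨g, rfl⟩)
    rw [← hmem, ← conj_rightPerm, ← hg]
    exact ⟨_, (hmem v).2 hv, rfl⟩

end Perm

end HopfGalois

end

theorem mainTheorem4 {K L E H : Type*}
    [Field K] [Field L] [Algebra K L] [FiniteDimensional K L] [Algebra.IsSeparable K L]
    [Field E] [Algebra K E] [Algebra L E] [IsScalarTower K L E] [IsNormalClosure K L E]
    [Ring H] [Bialgebra K H] [FiniteDimensional K H] [Module H L] [IsScalarTower K H L]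
    (hHG : HopfGalois.IsHopfGalois K H L) :
    -- there is a group `N` of order `[L : K]` with `E ⊗ H ≅ E[N]`
    (∃ (N : Type*) (_ : Group N), Nat.card N = Module.finrank K L ∧
      Nonempty (E ⊗[K] H ≃ₐc[E] MonoidAlgebra E N)) ∧
    -- and for every such group and isomorphism:
    ∀ (N : Type*) [Group N] (τ : E ⊗[K] H ≃ₐc[E] MonoidAlgebra E N),
      -- the correspondence, its two explicit maps, and its restriction to the normal objects
      (∃ Φ : {L₀ : IntermediateField K L // HopfGalois.IsHSubextension H L₀} ≃
          {V : Subgroup N // HopfGalois.IsGEquivariant τ V},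
        (∀ L₀, (Φ L₀).1 = HopfGalois.subgroupOfIdeal τ (HopfGalois.annihilator H L₀.1)) ∧
        (∀ V, ((Φ.symm V).1 : Set L) =
          HopfGalois.invariants K L (HopfGalois.idealOfSubgroup τ V.1 : Set H)) ∧
        (∀ L₀ L₁, L₀.1 ≤ L₁.1 ↔ (Φ L₁).1 ≤ (Φ L₀).1) ∧
        (∀ L₀, HopfGalois.IsHNormal H L₀.1 ↔ (Φ L₀).1.Normal)) ∧
      -- `N` embeds in `Perm(G/G')`, and there `G`-equivariant means normalized by `λ(G)`
      Function.Injective (HopfGalois.rightPerm (L := L) hHG.isModuleAlgebra τ) ∧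
      ∀ V : Subgroup N, HopfGalois.IsGEquivariant τ V ↔
        HopfGalois.leftTranslations K L E ≤ Subgroup.normalizer
          (V.op.map (HopfGalois.rightPerm (L := L) hHG.isModuleAlgebra τ) :
            Set (Equiv.Perm (Gal(E/K) ⧸ HopfGalois.galSub K L E))) := by
  have hL := hHG.isModuleAlgebra
  obtain ⟨_, _⟩ := HopfGalois.finiteDimensional_isGalois_of_isNormalClosure K L E
  refine ⟨HopfGalois.exists_group_equiv hHG (IsScalarTower.toAlgHom K L E)
    (AlgHom.natCard_of_splits K L E IsNormalClosure.splits), fun N _ τ => ⟨?_,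
      HopfGalois.rightPerm_injective hHG τ,
      HopfGalois.isGEquivariant_iff_leftTranslations_le_normalizer hHG τ⟩⟩
  let Φ : {L₀ : IntermediateField K L // HopfGalois.IsHSubextension H L₀} ≃
      {V : Subgroup N // HopfGalois.IsGEquivariant τ V} :=
    { toFun := fun L₀ => ⟨HopfGalois.subgroupOfIdeal τ (HopfGalois.annihilator H L₀.1),
        HopfGalois.isGEquivariant_subgroupOfIdeal hL τ L₀.1⟩
      invFun := fun V => ⟨HopfGalois.fixedBy hL τ V.1,
        HopfGalois.isHSubextension_fixedBy hHG V.2⟩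
      left_inv := fun L₀ =>
        Subtype.ext (HopfGalois.fixedBy_subgroupOfIdeal_annihilator hHG τ L₀.2)
      right_inv := fun V =>
        Subtype.ext (HopfGalois.subgroupOfIdeal_annihilator_fixedBy hHG V.2) }
  have hΦ : ∀ L₀, HopfGalois.fixedBy hL τ (Φ L₀).1 = L₀.1 := fun L₀ =>
    HopfGalois.fixedBy_subgroupOfIdeal_annihilator hHG τ L₀.2
  refine ⟨Φ, fun _ => rfl, fun V => HopfGalois.coe_fixedBy_eq_invariants hL V.2,
    fun L₀ L₁ => ⟨fun h n hn => ?_, fun h => ?_⟩, fun L₀ => ?_⟩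
  · exact (HopfGalois.mem_subgroupOfIdeal_annihilator_iff hL τ L₀.1 n).2 fun f x hx =>
      (HopfGalois.mem_subgroupOfIdeal_annihilator_iff hL τ L₁.1 n).1 hn f x (h hx)
  · rw [← hΦ L₀, ← hΦ L₁]
    exact HopfGalois.fixedBy_antitone hL τ h
  · rw [← HopfGalois.isHStable_fixedBy_iff_normal hHG (Φ L₀).2, hΦ L₀]
    exact ⟨fun h => h.2, fun h => ⟨L₀.2, h⟩⟩
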